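/- For $p\ge 1$ and $\sigma>0$, let $GGauss(p,\sigma)$ be the probability distribution on $\mathbb{R}^k$ whose density with respect to Lebesgue measure is proportional to $\exp(-(\|x\|_p/\sigma)^p)$, and let $\mathcal{M}^p_\sigma$ be the mechanism that on input $d\in\mathbb{R}^k$ samples $x\sim GGauss(p,\sigma)$ and outputs $d+x$. A mechanism $\mathcal{M}$ assigning to each $d\in\mathbb{R}^k$ a probability distribution $\mathcal{M}(d)$ on $\mathbb{R}^k$ is called $(\epsilon,\delta)$-differentially private (for sensitivity-$1$ queries) if $$\Pr_{\tilde d\sim\mathcal{M}(d)}[\tilde d\in S]\le e^{\epsilon}\Pr_{\tilde d\sim\mathcal{M}(d')}[\tilde d\in S]+\delta$$ for all $d,d'\in\mathbb{R}^k$ with $\|d-d'\|_\infty\le 1$ and all measurable $S\subseteq\mathbb{R}^k$. Then for all constants $C_1,C_2>0$ there is a constant $c>0$, depending only on $C_1$ and $C_2$, such that the following holds. Let $k$ be a positive integer, let $p$ be an even integer with $4\le p\le\log k$ (natural logarithm), let $0<\epsilon\le C_1$, let $\delta\in[2^{-C_2k/p},1/k]$, and let $$\sigma\ge c\cdot\frac{\sqrt{kp\log(1/\delta)}}{\epsilon}.$$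 Then $\mathcal{M}^p_\sigma$ is $(\epsilon,\delta)$-differentially private. In particular, $\sigma=\Theta\big(\sqrt{kp\log(1/\delta)}/\epsilon\big)$, with a sufficiently large constant, suffices. -/

import Mathlib

open MeasureTheory
open scoped ENNReal

noncomputable section

/-- The unnormalised density `exp (-(‖x‖_p / σ) ^ p)` on `ℝᵏ`, where `‖x‖_p` is the `ℓ_p` norm. -/
def gGaussWeight (k : ℕ) (p σ : ℝ) (x : Fin k → ℝ) : ℝ :=
  Real.exp (-(‖WithLp.toLp (ENNReal.ofReal p) x‖ / σ) ^ p)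

/-- The generalized Gaussian distribution `GGauss(p, σ)` on `ℝᵏ` with shape `p` and scale `σ`:
the distribution whose density with respect to Lebesgue measure is proportional to
`exp (-(‖x‖_p / σ) ^ p)`. -/
def gGauss (k : ℕ) (p σ : ℝ) : Measure (Fin k → ℝ) :=
  (∫⁻ x : Fin k → ℝ, ENNReal.ofReal (gGaussWeight k p σ x))⁻¹ •
    (volume : Measure (Fin k → ℝ)).withDensity
      (fun x => ENNReal.ofReal (gGaussWeight k p σ x))

/-- The generalized Gaussian mechanism: on input `d` it samples `x ∼ GGauss(p, σ)` and outputs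
`d + x`. The value at `d` is the law of the output. -/
def gGaussMechanism (k : ℕ) (p σ : ℝ) (d : Fin k → ℝ) : Measure (Fin k → ℝ) :=
  (gGauss k p σ).map (fun x => d + x)

/-- `(ε, δ)`-differential privacy, for sensitivity-1 queries, of a mechanism `M` sending each
`d ∈ ℝᵏ` to a probability distribution on `ℝᵏ`. The norm on `Fin k → ℝ` is the `ℓ_∞` norm. -/
structure IsDifferentiallyPrivate {k : ℕ} (ε δ : ℝ)
    (M : (Fin k → ℝ) → Measure (Fin k → ℝ)) : Prop where
  isProbabilityMeasure : ∀ d, IsProbabilityMeasure (M d)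
  measure_le : ∀ d d' : Fin k → ℝ, ‖d - d'‖ ≤ 1 → ∀ S : Set (Fin k → ℝ), MeasurableSet S →
    M d S ≤ ENNReal.ofReal (Real.exp ε) * M d' S + ENNReal.ofReal δ

end

/-! Write `V x = ∑ j, (x j / σ) ^ p`, `v = d - d'`, `t = log (1 / δ)`. The privacy loss at noise `x`
is `L = V (x + v) - V x`, and a Chernoff bound reduces privacy to `E[exp (l * L)] ≤ exp (l * ε) * δ`
for one `l ≥ 0` (`map_const_add_le_of_lintegral_exp_le`). The expectation factors over coordinates.

For one coordinate, rescaled by `σ`, the shift satisfies `|w| ≤ s = 1 / σ`. The first-order term `p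
* w * y ^ (p - 1)` of the loss is odd because `p` is even, so its mean vanishes. What remains is of
order `p² s²` times moments of `|y| ^ (p - 2)` and `|y| ^ (2 * (p - 1))`. Those moments are `O(1 /
p)`, so each factor is `exp (O((l + l²) * p * s²))` (`integral_exp_neg_pow_mul_exp_le`); this gain
of `1 / p` produces `√(k p t)`.

With `l = 2 * t / ε` the total exponent `O((l + l²) * k * p / σ²)` is at most `l * ε - t = t`. The
expansion needs `l * p / σ` small, which is where the lower bound on `δ` enters. -/

/-! ### Elementary inequalities for exponentials and powers. -/

theorem Real.exp_le_one_add_add_sq_mul_exp_abs (x : ℝ) :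
    Real.exp x ≤ 1 + x + x ^ 2 * Real.exp |x| := by
  have h1 : Real.exp x - 1 ≤ x * Real.exp x := by
    have h := mul_le_mul_of_nonneg_right (Real.add_one_le_exp (-x)) (Real.exp_pos x).le
    rw [← Real.exp_add, neg_add_cancel, Real.exp_zero] at h
    linarith
  have h2 := Real.add_one_le_exp x
  rcases le_total 0 x with hx | hx
  · rw [abs_of_nonneg hx]
    nlinarith [mul_le_mul_of_nonneg_left h1 hx]
  · have h3 : 1 ≤ Real.exp |x| := Real.one_le_exp (abs_nonneg x)
    nlinarith [mul_le_mul_of_nonneg_left h3 (sq_nonneg x)]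

theorem abs_add_pow_sub_pow_le (y w : ℝ) (n : ℕ) :
    |(y + w) ^ (n + 1) - y ^ (n + 1)| ≤ (n + 1) * |w| * (|y| + |w|) ^ n := by
  induction n with
  | zero => simp
  | succ n ih =>
    have h : (y + w) ^ (n + 1 + 1) - y ^ (n + 1 + 1)
        = (y + w) * ((y + w) ^ (n + 1) - y ^ (n + 1)) + w * y ^ (n + 1) := by ring
    have hy : |y| ^ (n + 1) ≤ (|y| + |w|) ^ (n + 1) := by
      gcongr; linarith [abs_nonneg w]
    rw [h]
    calc _ ≤ |y + w| * |(y + w) ^ (n + 1) - y ^ (n + 1)| + |w| * |y| ^ (n + 1) := by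
          rw [← abs_pow, ← abs_mul, ← abs_mul]; exact abs_add_le _ _
      _ ≤ (|y| + |w|) * ((n + 1) * |w| * (|y| + |w|) ^ n) + |w| * (|y| + |w|) ^ (n + 1) := by
          gcongr; exact abs_add_le _ _
      _ = _ := by push_cast; ring

theorem abs_add_pow_sub_pow_sub_le (y w : ℝ) (n : ℕ) :
    |(y + w) ^ (n + 2) - y ^ (n + 2) - (n + 2) * w * y ^ (n + 1)|
      ≤ (n + 1) * (n + 2) * w ^ 2 * (|y| + |w|) ^ n := by
  induction n with
  | zero =>
    have h : (y + w) ^ 2 - y ^ 2 - 2 * w * y = w ^ 2 := by ring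
    simp only [Nat.cast_zero, zero_add, pow_one, pow_zero, h]
    rw [abs_of_nonneg (sq_nonneg w)]; nlinarith [sq_nonneg w]
  | succ n ih =>
    have h : (y + w) ^ (n + 1 + 2) - y ^ (n + 1 + 2)
          - ((n + 1 : ℕ) + 2) * w * y ^ (n + 1 + 1)
        = (y + w) * ((y + w) ^ (n + 2) - y ^ (n + 2) - (n + 2) * w * y ^ (n + 1))
          + (n + 2) * w ^ 2 * y ^ (n + 1) := by push_cast; ring
    have hy : |y| ^ (n + 1) ≤ (|y| + |w|) ^ (n + 1) := by
      gcongr; linarith [abs_nonneg w]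
    rw [h]
    calc _ ≤ |y + w| * |(y + w) ^ (n + 2) - y ^ (n + 2) - (n + 2) * w * y ^ (n + 1)|
            + (n + 2) * w ^ 2 * |y| ^ (n + 1) := by
          have h2 : |((n : ℝ) + 2) * w ^ 2 * y ^ (n + 1)| = (n + 2) * w ^ 2 * |y| ^ (n + 1) := by
            rw [abs_mul, abs_pow, abs_of_nonneg (by positivity)]
          rw [← abs_mul, ← h2]; exact abs_add_le _ _
      _ ≤ (|y| + |w|) * ((n + 1) * (n + 2) * w ^ 2 * (|y| + |w|) ^ n)
            + (n + 2) * w ^ 2 * (|y| + |w|) ^ (n + 1) := by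
          gcongr; exact abs_add_le _ _
      _ = (n + 2) * (n + 2) * w ^ 2 * (|y| + |w|) ^ (n + 1) := by ring
      _ ≤ _ := by
          push_cast
          gcongr ?_ * _
          nlinarith [mul_nonneg (by positivity : (0 : ℝ) ≤ n + 2) (sq_nonneg w)]

/-- Convexity with weights `1 - 1 / p` on `a` and `1 / p` on `s`, instead of equal weights: the
factor on `a ^ m` stays below `e² < 9`, and the additive error is only `1 / p`, the size of the
moments it is added to. -/
theorem add_pow_le_const_mul_pow_add {p m : ℕ} (hp : 2 ≤ p) (hm : 1 ≤ m) (hmp : m ≤ 2 * (p - 1))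
    {a s : ℝ} (ha : 0 ≤ a) (hs : 0 ≤ s) (hps : p * s ≤ 1) :
    (a + s) ^ m ≤ 9 * a ^ m + 1 / p := by
  obtain ⟨q, rfl⟩ : ∃ q, p = q + 1 := ⟨p - 1, by omega⟩
  obtain ⟨n, rfl⟩ : ∃ n, m = n + 1 := ⟨m - 1, by omega⟩
  have hq : (1 : ℝ) ≤ q := by exact_mod_cast (by omega : 1 ≤ q)
  have hq0 : (0 : ℝ) < q := by linarith
  push_cast at hps ⊢
  have hconv := (convexOn_pow (n + 1) : ConvexOn ℝ (Set.Ici (0 : ℝ)) fun x => x ^ (n + 1)).2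
    (show a * ((q + 1) / q) ∈ Set.Ici (0 : ℝ) from Set.mem_Ici.2 (by positivity))
    (show (q + 1) * s ∈ Set.Ici (0 : ℝ) from Set.mem_Ici.2 (by positivity))
    (show (0 : ℝ) ≤ q / (q + 1) by positivity)
    (show (0 : ℝ) ≤ 1 / (q + 1) by positivity) (by field_simp)
  simp only [smul_eq_mul] at hconv
  have e1 : (q : ℝ) / (q + 1) * (a * ((q + 1) / q)) + 1 / (q + 1) * ((q + 1) * s) = a + s := by
    field_simp
  have e2 : (q : ℝ) / (q + 1) * (a * ((q + 1) / q)) ^ (n + 1)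
      = ((1 / q + 1 : ℝ)) ^ n * a ^ (n + 1) := by
    rw [mul_pow, show (1 / q + 1 : ℝ) = (q + 1) / q by field_simp; ring, pow_succ ((q + 1 : ℝ) / q)]
    field_simp
  rw [e1, e2] at hconv
  have h9 : ((1 / q + 1 : ℝ)) ^ n ≤ 9 := by
    calc ((1 / q + 1 : ℝ)) ^ n ≤ (Real.exp (1 / q)) ^ n := by
          gcongr; exact Real.add_one_le_exp _
      _ = Real.exp (n * (1 / q)) := (Real.exp_nat_mul _ _).symm
      _ ≤ Real.exp (2 * 1) := by
          apply Real.exp_le_exp.2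
          have : (n : ℝ) ≤ 2 * q := by exact_mod_cast (by omega : n ≤ 2 * q)
          rw [mul_one_div, div_le_iff₀ hq0]; linarith
      _ = Real.exp 1 ^ 2 := by rw [← Real.exp_nat_mul]; norm_num
      _ ≤ 3 ^ 2 := by gcongr; exact (Real.exp_one_lt_d9.trans (by norm_num)).le
      _ = 9 := by norm_num
  have h1 : ((q + 1) * s) ^ (n + 1) ≤ 1 := pow_le_one₀ (by positivity) hps
  calc (a + s) ^ (n + 1) ≤ _ := hconv
    _ ≤ 9 * a ^ (n + 1) + 1 / (q + 1) * 1 := by gcongr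
    _ = _ := by ring

/-! ### Moments of the one-dimensional density. -/

theorem integral_abs_eq_two_mul_integral_Ioi {p : ℕ} (q : ℕ) (b : ℝ) :
    ∫ x : ℝ, |x| ^ q * Real.exp (-b * |x| ^ p)
      = 2 * ∫ x in Set.Ioi (0 : ℝ), x ^ (q : ℝ) * Real.exp (-b * x ^ (p : ℝ)) := by
  simp_rw [Real.rpow_natCast]
  exact integral_comp_abs (f := fun x : ℝ => x ^ q * Real.exp (-b * x ^ p))

theorem integral_abs_pow_mul_exp_neg_mul_abs_pow {p : ℕ} (hp : 0 < p) (q : ℕ) {b : ℝ}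
    (hb : 0 < b) :
    ∫ x : ℝ, |x| ^ q * Real.exp (-b * |x| ^ p)
      = 2 / p * b ^ (-((q : ℝ) + 1) / p) * Real.Gamma (((q : ℝ) + 1) / p) := by
  rw [integral_abs_eq_two_mul_integral_Ioi,
    integral_rpow_mul_exp_neg_mul_rpow (by exact_mod_cast hp)
      (lt_of_lt_of_le (by norm_num) (Nat.cast_nonneg q)) hb]
  ring

theorem integrable_abs_pow_mul_exp_neg_mul_abs_pow {p : ℕ} (hp : 0 < p) (q : ℕ) {b : ℝ}
    (hb : 0 < b) :
    Integrable fun x : ℝ => |x| ^ q * Real.exp (-b * |x| ^ p) := by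
  -- A non-integrable function has integral `0` by convention, while the Gamma formula gives a
  -- positive value.
  refine not_imp_comm.1 integral_undef ?_
  rw [integral_abs_pow_mul_exp_neg_mul_abs_pow hp q hb]
  have h : 0 < Real.Gamma (((q : ℝ) + 1) / p) := Real.Gamma_pos_of_pos (by positivity)
  positivity

/-- Gamma is convex and equals `1` at both endpoints. -/
theorem Real.Gamma_le_one {x : ℝ} (h1 : 1 ≤ x) (h2 : x ≤ 2) : Real.Gamma x ≤ 1 := by
  have h := Real.convexOn_Gamma.2 (show (1 : ℝ) ∈ Set.Ioi 0 by simp)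
    (show (2 : ℝ) ∈ Set.Ioi 0 by simp) (sub_nonneg.2 h2) (sub_nonneg.2 h1) (by ring)
  simp only [smul_eq_mul, Real.Gamma_one, Real.Gamma_two] at h
  rwa [show (2 - x) * 1 + (x - 1) * 2 = x by ring, show (2 - x) * 1 + (x - 1) * 1 = 1 by ring] at h

theorem integral_exp_neg_mul_abs_pow_le {p : ℕ} (hp : 0 < p) {b : ℝ} (hb : 0 < b) :
    ∫ x : ℝ, Real.exp (-b * |x| ^ p) ≤ 2 * b ^ (-1 / (p : ℝ)) := by
  have h := integral_abs_pow_mul_exp_neg_mul_abs_pow hp 0 hb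
  have hp' : (1 : ℝ) ≤ p := by exact_mod_cast hp
  have hp0 : (0 : ℝ) < p := by linarith
  simp only [pow_zero, one_mul, Nat.cast_zero, zero_add] at h
  have h2 := Real.Gamma_add_one (s := 1 / (p : ℝ)) (by positivity)
  have h3 : Real.Gamma (1 / (p : ℝ) + 1) ≤ 1 :=
    Real.Gamma_le_one (by linarith [show 0 < 1 / (p : ℝ) by positivity])
      (by linarith [(div_le_one hp0).2 hp'])
  calc _ = 2 * b ^ (-1 / (p : ℝ)) * Real.Gamma (1 / (p : ℝ) + 1) := by rw [h, h2]; ring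
    _ ≤ 2 * b ^ (-1 / (p : ℝ)) * 1 := by gcongr
    _ = _ := mul_one _

theorem integral_exp_neg_half_mul_abs_pow_le {p : ℕ} (hp : 0 < p) :
    ∫ x : ℝ, Real.exp (-(1 / 2) * |x| ^ p) ≤ 4 := by
  have hp' : (1 : ℝ) ≤ p := by exact_mod_cast hp
  have h : ((1 : ℝ) / 2) ^ (-1 / (p : ℝ)) ≤ (1 / 2) ^ (-1 : ℝ) :=
    Real.rpow_le_rpow_of_exponent_ge (by norm_num) (by norm_num)
      (by rw [le_div_iff₀ (by linarith)]; linarith)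
  rw [Real.rpow_neg_one] at h
  linarith [integral_exp_neg_mul_abs_pow_le hp (one_half_pos (α := ℝ))]

theorem integrable_exp_neg_mul_abs_pow {p : ℕ} (hp : 0 < p) {b : ℝ} (hb : 0 < b) :
    Integrable fun x : ℝ => Real.exp (-b * |x| ^ p) := by
  simpa using integrable_abs_pow_mul_exp_neg_mul_abs_pow hp 0 hb

theorem le_integral_exp_neg_abs_pow {p : ℕ} (hp : 0 < p) :
    2 / 3 ≤ ∫ x : ℝ, Real.exp (-1 * |x| ^ p) := by
  have he : (1 : ℝ) / 3 ≤ Real.exp (-1) := by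
    rw [Real.exp_neg, one_div]
    exact inv_anti₀ (Real.exp_pos _) (Real.exp_one_lt_d9.trans (by norm_num)).le
  have h := setIntegral_mono_on (μ := volume) (s := Set.Icc (-1 : ℝ) 1)
    (f := fun _ => (1 : ℝ) / 3) (g := fun x : ℝ => Real.exp (-1 * |x| ^ p))
    (integrableOn_const (by simp)) (integrable_exp_neg_mul_abs_pow hp one_pos).integrableOn
    measurableSet_Icc (fun x hx => he.trans (Real.exp_le_exp.2 (by
      have := pow_le_one₀ (n := p) (abs_nonneg x) (abs_le.2 hx); linarith)))
  have h2 := setIntegral_le_integral (s := Set.Icc (-1 : ℝ) 1)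
    (integrable_exp_neg_mul_abs_pow hp one_pos)
    (Filter.Eventually.of_forall fun x => (Real.exp_pos _).le)
  rw [setIntegral_const] at h
  norm_num at h
  norm_num at h2 ⊢
  linarith

theorem integral_abs_pow_sub_two_mul_exp_neg_abs_pow_le {p : ℕ} (hp : 4 ≤ p) :
    ∫ x : ℝ, |x| ^ (p - 2) * Real.exp (-1 * |x| ^ p) ≤ 3 / p := by
  have hp' : (4 : ℝ) ≤ p := by exact_mod_cast hp
  rw [integral_abs_pow_mul_exp_neg_mul_abs_pow (by omega) _ one_pos, Real.one_rpow, mul_one,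
    Nat.cast_sub (by omega)]
  set t : ℝ := ((p : ℝ) - (2 : ℕ) + 1) / p with ht
  have ht0 : 3 / 4 ≤ t := by
    rw [ht, le_div_iff₀ (by linarith)]; push_cast; linarith
  have ht1 : t ≤ 1 := by
    rw [ht, div_le_iff₀ (by linarith)]; push_cast; linarith
  have h := Real.Gamma_add_one (s := t) (by linarith)
  have h1 : Real.Gamma (t + 1) ≤ 1 := Real.Gamma_le_one (by linarith) (by linarith)
  have h2 : 0 < Real.Gamma t := Real.Gamma_pos_of_pos (by linarith)
  have h3 : Real.Gamma t ≤ 3 / 2 := by nlinarith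
  calc 2 / (p : ℝ) * Real.Gamma t ≤ 2 / (p : ℝ) * (3 / 2) := by gcongr
    _ = 3 / p := by ring

theorem integral_abs_pow_mul_exp_neg_half_mul_abs_pow_le {p : ℕ} (hp : 1 ≤ p) :
    ∫ x : ℝ, |x| ^ (2 * (p - 1)) * Real.exp (-(1 / 2) * |x| ^ p) ≤ 8 / p := by
  have hp' : (1 : ℝ) ≤ p := by exact_mod_cast hp
  rw [integral_abs_pow_mul_exp_neg_mul_abs_pow (by omega) _ one_half_pos, neg_div]
  set t : ℝ := (((2 * (p - 1) : ℕ) : ℝ) + 1) / p with ht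
  have hc : ((2 * (p - 1) : ℕ) : ℝ) = 2 * (p - 1) := by
    rw [Nat.cast_mul, Nat.cast_sub hp]; norm_num
  have ht0 : 1 ≤ t := by
    rw [ht, hc, le_div_iff₀ (by linarith)]; linarith
  have ht1 : t ≤ 2 := by
    rw [ht, hc, div_le_iff₀ (by linarith)]; linarith
  have h1 : Real.Gamma t ≤ 1 := Real.Gamma_le_one ht0 ht1
  have h : ((1 : ℝ) / 2) ^ (-t) ≤ (1 / 2) ^ (-2 : ℝ) :=
    Real.rpow_le_rpow_of_exponent_ge (by norm_num) (by norm_num) (by linarith)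
  have h4 : ((1 : ℝ) / 2) ^ (-2 : ℝ) = 4 := by
    rw [Real.rpow_neg (by norm_num), Real.rpow_two]; norm_num
  have h0 : 0 < Real.Gamma t := Real.Gamma_pos_of_pos (by linarith)
  calc 2 / (p : ℝ) * (1 / 2) ^ (-t) * Real.Gamma t ≤ 2 / (p : ℝ) * 4 * 1 := by
        gcongr; linarith
    _ = 8 / p := by ring

/-! ### The moment generating function of one coordinate. -/

/-- Apply `exp x ≤ 1 + x + x² exp |x|` to `x = l * D`. The linear term in `w` is kept exact so that
it can cancel under the integral. -/
theorem exp_mul_add_pow_sub_pow_le {p : ℕ} (hp : 4 ≤ p) {l s w : ℝ} (hl : 0 ≤ l)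
    (hw : |w| ≤ s) (hps : p * s ≤ 1) (hlps : 20 * (l * p * s) ≤ 1) (y : ℝ) :
    Real.exp (l * ((y + w) ^ p - y ^ p)) ≤
      1 + l * p * w * y ^ (p - 1) + l * p ^ 2 * s ^ 2 * (9 * |y| ^ (p - 2) + 1 / p)
        + 2 * l ^ 2 * p ^ 2 * s ^ 2 * (9 * |y| ^ (2 * (p - 1)) + 1 / p)
          * Real.exp (1 / 2 * |y| ^ p) := by
  have hs : 0 ≤ s := (abs_nonneg w).trans hw
  have hp0 : (0 : ℝ) < p := by exact_mod_cast (by omega : 0 < p)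
  have hp1 : (1 : ℝ) / p ≤ 1 := by
    rw [div_le_one hp0]; exact_mod_cast (by omega : 1 ≤ p)
  set D := (y + w) ^ p - y ^ p with hD
  have hy := abs_nonneg y
  have hD1 : |D| ≤ p * s * (|y| + s) ^ (p - 1) := by
    have h := abs_add_pow_sub_pow_le y w (p - 1)
    rw [show p - 1 + 1 = p by omega, Nat.cast_sub (by omega), Nat.cast_one, sub_add_cancel] at h
    exact h.trans (by gcongr)
  have hD2 : D ≤ p * w * y ^ (p - 1) + p ^ 2 * s ^ 2 * (9 * |y| ^ (p - 2) + 1 / p) := by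
    have h := abs_add_pow_sub_pow_sub_le y w (p - 2)
    rw [show p - 2 + 2 = p by omega, show p - 2 + 1 = p - 1 by omega,
      Nat.cast_sub (by omega), Nat.cast_two, sub_add_cancel, ← hD, ← sq_abs w] at h
    have h2 : ((p : ℝ) - 2 + 1) * p * |w| ^ 2 * (|y| + |w|) ^ (p - 2)
        ≤ p ^ 2 * s ^ 2 * (|y| + s) ^ (p - 2) := by
      gcongr
      nlinarith
    have h3 : (p : ℝ) ^ 2 * s ^ 2 * (|y| + s) ^ (p - 2)
        ≤ p ^ 2 * s ^ 2 * (9 * |y| ^ (p - 2) + 1 / p) := by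
      gcongr
      exact add_pow_le_const_mul_pow_add (by omega) (by omega) (by omega) hy hs hps
    linarith [le_abs_self (D - p * w * y ^ (p - 1))]
  have hDsq : D ^ 2 ≤ p ^ 2 * s ^ 2 * (9 * |y| ^ (2 * (p - 1)) + 1 / p) := by
    rw [← sq_abs D]
    calc |D| ^ 2 ≤ (p * s * (|y| + s) ^ (p - 1)) ^ 2 := by gcongr
      _ = p ^ 2 * s ^ 2 * (|y| + s) ^ (2 * (p - 1)) := by
          rw [mul_pow, mul_pow, ← pow_mul, mul_comm 2 (p - 1)]
      _ ≤ _ := by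
          gcongr
          exact add_pow_le_const_mul_pow_add (by omega) (by omega) (by omega) hy hs hps
  have hexp : Real.exp |l * D| ≤ 2 * Real.exp (1 / 2 * |y| ^ p) := by
    -- The factor `20` in `hlps` is chosen so that the remainder consumes only half of the decay
    -- `exp (-|y| ^ p)`.
    have h1 : |l * D| ≤ 1 / 2 + 1 / 2 * |y| ^ p := by
      have h2 : (|y| + s) ^ (p - 1) ≤ 9 * |y| ^ (p - 1) + 1 / p :=
        add_pow_le_const_mul_pow_add (by omega) (by omega) (by omega) hy hs hps
      have h3 : |y| ^ (p - 1) ≤ 1 + |y| ^ p := by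
        rcases le_total |y| 1 with h | h
        · linarith [pow_le_one₀ (n := p - 1) hy h, pow_nonneg hy p]
        · linarith [pow_le_pow_right₀ h (show p - 1 ≤ p by omega)]
      have h4 : 0 ≤ |y| ^ p := pow_nonneg hy p
      rw [abs_mul, abs_of_nonneg hl]
      calc l * |D| ≤ l * (p * s * (|y| + s) ^ (p - 1)) := by gcongr
        _ = (l * p * s) * (|y| + s) ^ (p - 1) := by ring
        _ ≤ (l * p * s) * (10 * (1 + |y| ^ p)) := by gcongr; linarith
        _ ≤ (1 / 20) * (10 * (1 + |y| ^ p)) := by gcongr; linarith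
        _ = _ := by ring
    have h5 : Real.exp (1 / 2) ≤ 2 := by
      have h6 : Real.exp (1 / 2) ^ 2 = Real.exp 1 := by rw [← Real.exp_nat_mul]; norm_num
      nlinarith [Real.exp_one_lt_d9, Real.exp_pos (1 / 2)]
    calc Real.exp |l * D| ≤ Real.exp (1 / 2 + 1 / 2 * |y| ^ p) := Real.exp_le_exp.2 h1
      _ = Real.exp (1 / 2) * Real.exp (1 / 2 * |y| ^ p) := Real.exp_add _ _
      _ ≤ _ := by gcongr
  calc Real.exp (l * D) ≤ 1 + l * D + (l * D) ^ 2 * Real.exp |l * D| :=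
        Real.exp_le_one_add_add_sq_mul_exp_abs _
    _ ≤ 1 + l * (p * w * y ^ (p - 1) + p ^ 2 * s ^ 2 * (9 * |y| ^ (p - 2) + 1 / p))
        + (l ^ 2 * (p ^ 2 * s ^ 2 * (9 * |y| ^ (2 * (p - 1)) + 1 / p)))
          * (2 * Real.exp (1 / 2 * |y| ^ p)) := by
        rw [mul_pow]; gcongr
    _ = _ := by ring

/-- Bound on the moment generating function of the privacy loss of one coordinate. -/
theorem integral_exp_neg_pow_mul_exp_le {p : ℕ} (hpe : Even p) (hp : 4 ≤ p) {l s w : ℝ}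
    (hl : 0 ≤ l) (hw : |w| ≤ s) (hps : p * s ≤ 1) (hlps : 20 * (l * p * s) ≤ 1) :
    Integrable (fun y : ℝ => Real.exp (-y ^ p) * Real.exp (l * ((y + w) ^ p - y ^ p))) ∧
    ∫ y : ℝ, Real.exp (-y ^ p) * Real.exp (l * ((y + w) ^ p - y ^ p))
      ≤ Real.exp (228 * (l + l ^ 2) * (p * s ^ 2)) * ∫ y : ℝ, Real.exp (-y ^ p) := by
  have hs : 0 ≤ s := (abs_nonneg w).trans hw
  have hpp : 0 < p := by omega
  have hp0 : (0 : ℝ) < p := by exact_mod_cast hpp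
  have hev : ∀ y : ℝ, Real.exp (-y ^ p) = Real.exp (-1 * |y| ^ p) := fun y => by
    rw [hpe.pow_abs, neg_one_mul]
  have i1 := integrable_exp_neg_mul_abs_pow hpp one_pos
  have i2 := integrable_abs_pow_mul_exp_neg_mul_abs_pow hpp (p - 2) one_pos
  have i3 := integrable_abs_pow_mul_exp_neg_mul_abs_pow hpp (2 * (p - 1)) (one_half_pos (α := ℝ))
  have i4 := integrable_exp_neg_mul_abs_pow hpp (one_half_pos (α := ℝ))
  have i5 : Integrable fun x : ℝ => x ^ (p - 1) * Real.exp (-1 * |x| ^ p) := by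
    refine (integrable_abs_pow_mul_exp_neg_mul_abs_pow hpp (p - 1) one_pos).mono'
      (by fun_prop) (Filter.Eventually.of_forall fun x => ?_)
    rw [norm_mul, norm_pow, Real.norm_eq_abs, Real.norm_eq_abs, Real.abs_exp]
  have h5 : ∫ x : ℝ, x ^ (p - 1) * Real.exp (-1 * |x| ^ p) = 0 := by
    have hodd : Odd (p - 1) := Nat.Even.sub_odd (by omega) hpe odd_one
    have h := integral_neg_eq_self (fun x : ℝ => x ^ (p - 1) * Real.exp (-1 * |x| ^ p)) volume
    simp only [abs_neg, hodd.neg_pow, neg_mul _ (Real.exp _), integral_neg] at h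
    linarith
  set a := l * p * w
  set b := l * p ^ 2 * s ^ 2 with hb
  set c := 2 * l ^ 2 * p ^ 2 * s ^ 2 with hc
  have hb0 : 0 ≤ b := by positivity
  have hc0 : 0 ≤ c := by positivity
  have hle : ∀ y : ℝ, Real.exp (-y ^ p) * Real.exp (l * ((y + w) ^ p - y ^ p)) ≤
      (1 + b * (1 / p)) * Real.exp (-1 * |y| ^ p) + a * (y ^ (p - 1) * Real.exp (-1 * |y| ^ p))
      + 9 * b * (|y| ^ (p - 2) * Real.exp (-1 * |y| ^ p))
      + 9 * c * (|y| ^ (2 * (p - 1)) * Real.exp (-(1 / 2) * |y| ^ p))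
      + c * (1 / p) * Real.exp (-(1 / 2) * |y| ^ p) := fun y => by
    have h := exp_mul_add_pow_sub_pow_le hp hl hw hps hlps y
    have he : Real.exp (-1 * |y| ^ p) * Real.exp (1 / 2 * |y| ^ p)
        = Real.exp (-(1 / 2) * |y| ^ p) := by
      rw [← Real.exp_add]; ring_nf
    rw [hev, ← he]
    refine (mul_le_mul_of_nonneg_left h (Real.exp_pos _).le).trans_eq ?_
    ring
  have iG := ((((i1.const_mul (1 + b * (1 / p))).add (i5.const_mul a)).add
    (i2.const_mul (9 * b))).add (i3.const_mul (9 * c))).add (i4.const_mul (c * (1 / p)))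
  have iF : Integrable fun y : ℝ =>
      Real.exp (-y ^ p) * Real.exp (l * ((y + w) ^ p - y ^ p)) :=
    iG.mono' (by fun_prop) (Filter.Eventually.of_forall fun x => by
      rw [Real.norm_of_nonneg (by positivity)]; exact hle x)
  refine ⟨iF, (integral_mono iF iG hle).trans ?_⟩
  rw [integral_add' ((((i1.const_mul (1 + b * (1 / p))).add (i5.const_mul a)).add
    (i2.const_mul (9 * b))).add (i3.const_mul (9 * c))) (i4.const_mul (c * (1 / p))),
    integral_add' (((i1.const_mul (1 + b * (1 / p))).add (i5.const_mul a)).add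
    (i2.const_mul (9 * b))) (i3.const_mul (9 * c)),
    integral_add' ((i1.const_mul (1 + b * (1 / p))).add (i5.const_mul a)) (i2.const_mul (9 * b)),
    integral_add' (i1.const_mul (1 + b * (1 / p))) (i5.const_mul a)]
  simp only [integral_const_mul, h5, hev]
  have b1 := integral_exp_neg_mul_abs_pow_le hpp one_pos
  have b1' := le_integral_exp_neg_abs_pow hpp
  have b2 := integral_abs_pow_sub_two_mul_exp_neg_abs_pow_le hp
  have b3 := integral_abs_pow_mul_exp_neg_half_mul_abs_pow_le hpp
  have b4 := integral_exp_neg_half_mul_abs_pow_le hpp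
  rw [Real.one_rpow] at b1
  set Z := ∫ y : ℝ, Real.exp (-1 * |y| ^ p)
  have hbp : b / p = l * (p * s ^ 2) := by rw [hb]; field_simp
  have hcp : c / p = 2 * l ^ 2 * (p * s ^ 2) := by rw [hc]; field_simp
  set r := (p : ℝ) * s ^ 2
  have hr : 0 ≤ r := by positivity
  calc _ ≤ (1 + b * (1 / p)) * Z + a * 0 + 9 * b * (3 / p) + 9 * c * (8 / p)
          + c * (1 / p) * 4 := by gcongr
    _ = Z + b / p * (Z + 27) + 76 * (c / p) := by ring
    _ ≤ Z + l * r * 29 + 152 * (l ^ 2 * r) := by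
        rw [hbp, hcp]
        nlinarith [mul_nonneg hl hr]
    -- `228 = 152 * 3 / 2`: the error is made proportional to `Z` through `Z ≥ 2 / 3`.
    _ ≤ Z + 228 * (l + l ^ 2) * r * (2 / 3) := by
        nlinarith [mul_nonneg hl hr]
    _ ≤ Z + 228 * (l + l ^ 2) * r * Z := by gcongr
    _ = (228 * (l + l ^ 2) * r + 1) * Z := by ring
    _ ≤ _ := by
        gcongr
        exact Real.add_one_le_exp _

/-! ### From the moment generating function to privacy. -/

theorem gGaussWeight_eq_exp_neg_sum {k p : ℕ} (hpe : Even p) (hp : 0 < p) (σ : ℝ)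
    (x : Fin k → ℝ) : gGaussWeight k p σ x = Real.exp (-∑ j, (x j / σ) ^ p) := by
  have hp0 : (0 : ℝ) < p := by exact_mod_cast hp
  have ht : (ENNReal.ofReal (p : ℝ)).toReal = p := ENNReal.toReal_ofReal hp0.le
  have hnn : 0 ≤ ∑ j, |x j| ^ p := Finset.sum_nonneg fun j _ => by positivity
  rw [gGaussWeight, PiLp.norm_eq_sum (by rw [ht]; exact hp0), ht]
  simp only [Real.norm_eq_abs, Real.rpow_natCast]
  rw [div_pow, ← Real.rpow_natCast, ← Real.rpow_mul hnn, one_div_mul_cancel hp0.ne', Real.rpow_one,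
    Finset.sum_div]
  simp only [div_pow, hpe.pow_abs]

/-- A bound on the moment generating function of the privacy loss gives `(ε, δ)`-indistinguishability
of two translates of the distribution with density proportional to `exp (-V)`. -/
theorem map_const_add_le_of_lintegral_exp_le {G : Type*} [AddCommGroup G] [MeasurableSpace G]
    [MeasurableAdd₂ G] (ν : Measure G) [ν.IsAddRightInvariant] {V : G → ℝ} (hV : Measurable V)
    {l ε δ : ℝ} (hl : 0 ≤ l) (d d' : G)
    (h : ∫⁻ x, ENNReal.ofReal (Real.exp (-V x) * Real.exp (l * (V (x + (d - d')) - V x))) ∂ν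
      ≤ ENNReal.ofReal (Real.exp (l * ε) * δ) * ∫⁻ x, ENNReal.ofReal (Real.exp (-V x)) ∂ν)
    {S : Set G} (hS : MeasurableSet S) :
    ((∫⁻ x, ENNReal.ofReal (Real.exp (-V x)) ∂ν)⁻¹ •
        ν.withDensity (fun x => ENNReal.ofReal (Real.exp (-V x)))).map (fun x => d + x) S ≤
      ENNReal.ofReal (Real.exp ε) * ((∫⁻ x, ENNReal.ofReal (Real.exp (-V x)) ∂ν)⁻¹ •
        ν.withDensity (fun x => ENNReal.ofReal (Real.exp (-V x)))).map (fun x => d' + x) S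
      + ENNReal.ofReal δ := by
  set N := ∫⁻ x, ENNReal.ofReal (Real.exp (-V x)) ∂ν with hN
  have hA : ∀ e : G, MeasurableSet ((fun x => e + x) ⁻¹' S) := fun e => measurable_const_add e hS
  have hW : Measurable fun x => ENNReal.ofReal (Real.exp (-V x)) := by fun_prop
  have hWv : Measurable fun x => ENNReal.ofReal (Real.exp (-V (x + (d - d')))) :=
    hW.comp (measurable_add_const _)
  have hL : Measurable fun x =>
      ENNReal.ofReal (Real.exp (-V x) * Real.exp (l * (V (x + (d - d')) - V x))) := by
    have := hV.comp (measurable_add_const (d - d'))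
    simp only [Function.comp_def] at this
    fun_prop
  have hmap : ∀ e : G, (N⁻¹ • ν.withDensity (fun x => ENNReal.ofReal (Real.exp (-V x)))).map
      (fun x => e + x) S
      = N⁻¹ * ∫⁻ x, ((fun x => e + x) ⁻¹' S).indicator
        (fun x => ENNReal.ofReal (Real.exp (-V x))) x ∂ν := fun e => by
    rw [Measure.map_apply (measurable_const_add e) hS, Measure.smul_apply, smul_eq_mul,
      withDensity_apply _ (hA e), lintegral_indicator (hA e)]
  have htrans : ∫⁻ x, ((fun x => d' + x) ⁻¹' S).indicator
        (fun x => ENNReal.ofReal (Real.exp (-V x))) x ∂ν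
      = ∫⁻ x, ((fun x => d + x) ⁻¹' S).indicator
        (fun x => ENNReal.ofReal (Real.exp (-V (x + (d - d'))))) x ∂ν := by
    rw [← lintegral_add_right_eq_self _ (d - d')]
    refine lintegral_congr fun x => ?_
    have hx : x + (d - d') ∈ (fun x => d' + x) ⁻¹' S ↔ x ∈ (fun x => d + x) ⁻¹' S := by
      rw [Set.mem_preimage, Set.mem_preimage, show d' + (x + (d - d')) = d + x by abel]
    by_cases h : x ∈ (fun x => d + x) ⁻¹' S
    · rw [Set.indicator_of_mem h, Set.indicator_of_mem (hx.2 h)]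
    · rw [Set.indicator_of_notMem h, Set.indicator_of_notMem (mt hx.1 h)]
  -- Where the loss is at most `ε` the first term suffices; elsewhere `exp (l * (loss - ε)) ≥ 1`, so
  -- the second does.
  have hpt : ∀ x, ((fun x => d + x) ⁻¹' S).indicator
        (fun x => ENNReal.ofReal (Real.exp (-V x))) x ≤
      ENNReal.ofReal (Real.exp ε) * ((fun x => d + x) ⁻¹' S).indicator
        (fun x => ENNReal.ofReal (Real.exp (-V (x + (d - d'))))) x
      + ENNReal.ofReal (Real.exp (-(l * ε))) *
        ENNReal.ofReal (Real.exp (-V x) * Real.exp (l * (V (x + (d - d')) - V x))) := fun x => by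
    by_cases hx : x ∈ (fun x => d + x) ⁻¹' S
    · simp only [Set.indicator_of_mem hx]
      rw [← ENNReal.ofReal_mul (Real.exp_pos _).le, ← ENNReal.ofReal_mul (Real.exp_pos _).le,
        ← Real.exp_add, ← Real.exp_add, ← Real.exp_add]
      rcases le_total (V (x + (d - d')) - V x) ε with hε | hε
      · refine le_trans (ENNReal.ofReal_le_ofReal (Real.exp_le_exp.2 ?_)) le_self_add
        linarith
      · refine le_trans (ENNReal.ofReal_le_ofReal (Real.exp_le_exp.2 ?_)) le_add_self
        linarith [mul_le_mul_of_nonneg_left hε hl]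
    · simp [Set.indicator_of_notMem hx]
  rw [hmap, hmap, htrans]
  calc _ ≤ N⁻¹ * ∫⁻ x, (ENNReal.ofReal (Real.exp ε) * ((fun x => d + x) ⁻¹' S).indicator
        (fun x => ENNReal.ofReal (Real.exp (-V (x + (d - d'))))) x
      + ENNReal.ofReal (Real.exp (-(l * ε))) *
        ENNReal.ofReal (Real.exp (-V x) * Real.exp (l * (V (x + (d - d')) - V x)))) ∂ν := by
        gcongr with x; exact hpt x
    _ ≤ N⁻¹ * (ENNReal.ofReal (Real.exp ε) * ∫⁻ x, ((fun x => d + x) ⁻¹' S).indicator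
        (fun x => ENNReal.ofReal (Real.exp (-V (x + (d - d'))))) x ∂ν
        + ENNReal.ofReal (Real.exp (-(l * ε))) * (ENNReal.ofReal (Real.exp (l * ε) * δ) * N)) := by
        rw [lintegral_add_right _ (hL.const_mul _), lintegral_const_mul _ (hWv.indicator (hA d)),
          lintegral_const_mul _ hL]
        gcongr
    _ = ENNReal.ofReal (Real.exp ε) * (N⁻¹ * ∫⁻ x, ((fun x => d + x) ⁻¹' S).indicator
        (fun x => ENNReal.ofReal (Real.exp (-V (x + (d - d'))))) x ∂ν)
        + (N⁻¹ * N) * ENNReal.ofReal δ := by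
        have he : ENNReal.ofReal (Real.exp (-(l * ε))) * ENNReal.ofReal (Real.exp (l * ε) * δ)
            = ENNReal.ofReal δ := by
          rw [← ENNReal.ofReal_mul (Real.exp_pos _).le, ← mul_assoc, ← Real.exp_add,
            neg_add_cancel, Real.exp_zero, one_mul]
        rw [mul_add, ← mul_assoc (ENNReal.ofReal (Real.exp (-(l * ε)))), he]
        ring
    _ ≤ _ := by
        gcongr
        -- `N⁻¹ * N ≤ 1` holds even for `N = 0` or `N = ∞`, so no condition on the normalisation is
        -- needed.
        exact (mul_le_mul_left (ENNReal.inv_mul_le_one N) _).trans_eq (one_mul _)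

/-! ### Normalisation and the product over coordinates. -/

theorem integrable_exp_neg_div_pow {p : ℕ} (hpe : Even p) (hp : 0 < p) {σ : ℝ} (hσ : 0 < σ) :
    Integrable fun x : ℝ => Real.exp (-(x / σ) ^ p) := by
  have h := (integrable_exp_neg_mul_abs_pow hp one_pos).comp_div hσ.ne'
  simpa only [hpe.pow_abs, neg_one_mul] using h

theorem isProbabilityMeasure_gGauss {k p : ℕ} (hpe : Even p) (hp : 0 < p) {σ : ℝ} (hσ : 0 < σ) :
    IsProbabilityMeasure (gGauss k p σ) := by
  have hint : Integrable fun x : Fin k → ℝ => gGaussWeight k p σ x := by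
    simp only [gGaussWeight_eq_exp_neg_sum hpe hp σ, ← Finset.sum_neg_distrib, Real.exp_sum]
    exact Integrable.fintype_prod fun _ => integrable_exp_neg_div_pow hpe hp hσ
  have h0 : (∫⁻ x : Fin k → ℝ, ENNReal.ofReal (gGaussWeight k p σ x)) ≠ 0 := by
    rw [Ne, lintegral_eq_zero_iff' hint.aemeasurable.ennreal_ofReal]
    intro h
    have h2 : ∀ᵐ x : Fin k → ℝ, False := by
      filter_upwards [h] with x hx
      exact absurd hx (by simp [gGaussWeight, Real.exp_pos])
    exact h2.exists.elim fun _ => id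
  refine ⟨?_⟩
  rw [gGauss, Measure.smul_apply, withDensity_apply _ MeasurableSet.univ, Measure.restrict_univ,
    smul_eq_mul]
  exact ENNReal.inv_mul_cancel h0 hint.lintegral_lt_top.ne

/-- Both integrands are products over coordinates, so `k` one-coordinate bounds multiply. Rescaling
by `σ` gives the same Jacobian on both sides. -/
theorem lintegral_exp_neg_sum_mul_exp_le {k p : ℕ} (hpe : Even p) (hp : 4 ≤ p) {l σ : ℝ}
    (hl : 0 ≤ l) (hσ : 0 < σ) (hpσ : p * σ⁻¹ ≤ 1) (hlpσ : 20 * (l * p * σ⁻¹) ≤ 1)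
    {v : Fin k → ℝ} (hv : ‖v‖ ≤ 1) :
    ∫⁻ x : Fin k → ℝ, ENNReal.ofReal (Real.exp (-∑ j, (x j / σ) ^ p) *
        Real.exp (l * (∑ j, ((x + v) j / σ) ^ p - ∑ j, (x j / σ) ^ p)))
      ≤ ENNReal.ofReal (Real.exp (228 * (l + l ^ 2) * (k * p * σ⁻¹ ^ 2))) *
        ∫⁻ x : Fin k → ℝ, ENNReal.ofReal (Real.exp (-∑ j, (x j / σ) ^ p)) := by
  have hv' : ∀ j, |v j / σ| ≤ σ⁻¹ := fun j => by
    have h := (norm_le_pi_norm v j).trans hv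
    rw [Real.norm_eq_abs] at h
    rw [abs_div, abs_of_pos hσ, div_eq_mul_inv]
    exact mul_le_of_le_one_left (by positivity) h
  have hmgf := fun j => integral_exp_neg_pow_mul_exp_le hpe hp hl (hv' j) hpσ hlpσ
  set g : ℝ → ℝ → ℝ := fun w y => Real.exp (-y ^ p) * Real.exp (l * ((y + w) ^ p - y ^ p)) with hg
  have e1 : ∀ x : Fin k → ℝ, Real.exp (-∑ j, (x j / σ) ^ p) *
        Real.exp (l * (∑ j, ((x + v) j / σ) ^ p - ∑ j, (x j / σ) ^ p))
      = ∏ j, g (v j / σ) (x j / σ) := fun x => by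
    simp only [hg]
    rw [Finset.prod_mul_distrib, ← Real.exp_sum, ← Real.exp_sum, Finset.sum_neg_distrib,
      ← Finset.mul_sum, Finset.sum_sub_distrib]
    simp only [Pi.add_apply, add_div]
  have e2 : ∀ x : Fin k → ℝ, Real.exp (-∑ j, (x j / σ) ^ p)
      = ∏ j, Real.exp (-(x j / σ) ^ p) := fun x => by
    rw [← Real.exp_sum, Finset.sum_neg_distrib]
  have i1 : Integrable fun x : Fin k → ℝ => ∏ j, g (v j / σ) (x j / σ) :=
    Integrable.fintype_prod (f := fun j y => g (v j / σ) (y / σ))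
      fun j => (hmgf j).1.comp_div hσ.ne'
  have i2 : Integrable fun x : Fin k → ℝ => ∏ j, Real.exp (-(x j / σ) ^ p) :=
    Integrable.fintype_prod (f := fun _ y => Real.exp (-(y / σ) ^ p))
      fun _ => integrable_exp_neg_div_pow hpe (by omega) hσ
  simp_rw [e1, e2]
  rw [← ofReal_integral_eq_lintegral_ofReal i1
      (Filter.Eventually.of_forall fun x => Finset.prod_nonneg fun j _ => by positivity),
    ← ofReal_integral_eq_lintegral_ofReal i2
      (Filter.Eventually.of_forall fun x => Finset.prod_nonneg fun j _ => by positivity),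
    ← ENNReal.ofReal_mul (Real.exp_pos _).le]
  refine ENNReal.ofReal_le_ofReal ?_
  rw [integral_fintype_prod_volume_eq_prod (fun j y => g (v j / σ) (y / σ)),
    integral_fintype_prod_volume_eq_prod (fun (_ : Fin k) y => Real.exp (-(y / σ) ^ p))]
  have e3 : Real.exp (228 * (l + l ^ 2) * (k * p * σ⁻¹ ^ 2))
      = ∏ _j : Fin k, Real.exp (228 * (l + l ^ 2) * (p * σ⁻¹ ^ 2)) := by
    rw [Finset.prod_const, ← Real.exp_nat_mul, Finset.card_univ, Fintype.card_fin]
    ring_nf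
  rw [e3, ← Finset.prod_mul_distrib]
  refine Finset.prod_le_prod (fun j _ => integral_nonneg fun y => by positivity) fun j _ => ?_
  rw [Measure.integral_comp_div (g (v j / σ)) σ,
    Measure.integral_comp_div (fun y => Real.exp (-y ^ p)) σ, smul_eq_mul, smul_eq_mul,
    mul_left_comm]
  exact mul_le_mul_of_nonneg_left (hmgf j).2 (abs_nonneg σ)

/-- Privacy of the generalized Gaussian mechanism under explicit conditions on the order `l` at which
the moment generating function of the privacy loss is evaluated. -/
theorem isDifferentiallyPrivate_gGaussMechanism {k p : ℕ} (hpe : Even p) (hp : 4 ≤ p)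
    {l σ ε δ : ℝ} (hl : 0 ≤ l) (hσ : 0 < σ) (hpσ : p * σ⁻¹ ≤ 1) (hlpσ : 20 * (l * p * σ⁻¹) ≤ 1)
    (hmgf : Real.exp (228 * (l + l ^ 2) * (k * p * σ⁻¹ ^ 2)) ≤ Real.exp (l * ε) * δ) :
    IsDifferentiallyPrivate ε δ (gGaussMechanism k p σ) where
  isProbabilityMeasure d := by
    have := isProbabilityMeasure_gGauss (k := k) hpe (show 0 < p by omega) hσ
    exact Measure.isProbabilityMeasure_map (measurable_const_add d).aemeasurable
  measure_le d d' hd S hS := by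
    simp only [gGaussMechanism, gGauss, gGaussWeight_eq_exp_neg_sum hpe (show 0 < p by omega) σ]
    have hV : Measurable fun x : Fin k → ℝ => ∑ j, (x j / σ) ^ p := by fun_prop
    have h := (lintegral_exp_neg_sum_mul_exp_le hpe hp hl hσ hpσ hlpσ hd).trans
      (mul_le_mul_left (ENNReal.ofReal_le_ofReal hmgf)
        (∫⁻ x : Fin k → ℝ, ENNReal.ofReal (Real.exp (-∑ j, (x j / σ) ^ p))))
    exact map_const_add_le_of_lintegral_exp_le volume hV hl d d' h hS

/-! ### Choice of parameters. -/

theorem mainTheorem4 (C₁ C₂ : ℝ) (hC₁ : 0 < C₁) (hC₂ : 0 < C₂) :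
    ∃ c : ℝ, 0 < c ∧
      ∀ (k p : ℕ) (ε δ σ : ℝ),
        Even p → 4 ≤ p → (p : ℝ) ≤ Real.log (k : ℝ) →
        0 < ε → ε ≤ C₁ →
        (2 : ℝ) ^ (-(C₂ * ((k : ℝ) / (p : ℝ)))) ≤ δ → δ ≤ 1 / (k : ℝ) →
        c * (Real.sqrt ((k : ℝ) * (p : ℝ) * Real.log (1 / δ)) / ε) ≤ σ →
        IsDifferentiallyPrivate ε δ (gGaussMechanism k (p : ℝ) σ) := by
  have hQ : 0 < √C₂ := Real.sqrt_pos.2 hC₂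
  have hQ2 : √C₂ ^ 2 = C₂ := Real.sq_sqrt hC₂.le
  set Q := √C₂
  -- One summand per requirement: `1` gives `c ≤ c²`, `40 * Q` gives `20 * (l * p / σ) ≤ 1`, `C₁ *
  -- Q` gives `p / σ ≤ 1`, and the last bounds the exponent by `t`.
  set c := 1 + 40 * Q + C₁ * Q + 456 * (C₁ + 2) with hc
  have hC₁Q : 0 < C₁ * Q := by positivity
  have hc1 : 1 ≤ c := by linarith
  refine ⟨c, by linarith, fun k p ε δ σ hpe hp hpk hε hεC hδ hδk hσ => ?_⟩
  have hp4 : (4 : ℝ) ≤ p := by exact_mod_cast hp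
  have hp0 : (0 : ℝ) < p := by linarith
  have hk0 : (0 : ℝ) < k := by
    rcases Nat.eq_zero_or_pos k with rfl | h
    · rw [Nat.cast_zero, Real.log_zero] at hpk; linarith
    · exact_mod_cast h
  have hδ0 : 0 < δ := lt_of_lt_of_le (by positivity) hδ
  set t := Real.log (1 / δ) with ht
  have htδ : Real.exp (-t) = δ := by
    rw [ht, one_div, Real.log_inv, neg_neg, Real.exp_log hδ0]
  -- From `δ ≤ 1 / k`: `t ≥ log k ≥ p ≥ 4`.
  have ht1 : 1 ≤ t := by
    have h : Real.log k ≤ t := by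
      rw [ht]
      refine Real.log_le_log hk0 ?_
      rw [le_div_iff₀ hδ0]
      rw [le_div_iff₀ hk0] at hδk
      linarith
    linarith
  have htk : t * p ≤ C₂ * k := by
    have h := Real.log_le_log (by positivity) hδ
    rw [Real.log_rpow two_pos, ← neg_neg (Real.log δ), ← Real.log_inv, ← one_div, ← ht] at h
    have h2 : t ≤ C₂ * (k / p) * 1 := by
      have h3 : C₂ * (k / p) * Real.log 2 ≤ C₂ * (k / p) * 1 := by
        gcongr; linarith [Real.log_two_lt_d9]
      linarith
    rwa [mul_one, ← mul_div_assoc, le_div_iff₀ hp0] at h2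
  set T := √((k : ℝ) * p * t) with hT
  have hT2 : T ^ 2 = k * p * t := Real.sq_sqrt (by positivity)
  have hT0 : 0 < T := Real.sqrt_pos.2 (by positivity)
  have hTQ : t * p ≤ T * Q := by
    refine le_of_sq_le_sq ?_ (by positivity)
    rw [mul_pow T, hT2, hQ2]
    nlinarith [mul_le_mul_of_nonneg_left htk (by positivity : 0 ≤ t * p)]
  have hσ0 : 0 < σ := lt_of_lt_of_le (by positivity) hσ
  have hs : σ⁻¹ ≤ ε / (c * T) := by
    rw [inv_le_comm₀ hσ0 (by positivity), inv_div, mul_div_assoc]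
    exact hσ
  have hps : t * (p * σ⁻¹) ≤ ε * Q / c := by
    calc t * (p * σ⁻¹) ≤ t * (p * (ε / (c * T))) := by gcongr
      _ = t * p * (ε / (c * T)) := by ring
      _ ≤ T * Q * (ε / (c * T)) := by gcongr
      _ = _ := by field_simp
  have hks : k * p * σ⁻¹ ^ 2 ≤ ε ^ 2 / (c * t) := by
    calc k * p * σ⁻¹ ^ 2 ≤ k * p * (ε / (c * T)) ^ 2 := by gcongr
      _ = ε ^ 2 / (c ^ 2 * t) := by
          rw [div_pow, mul_pow, hT2]; field_simp
      _ ≤ _ := by gcongr; nlinarith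
  -- This `l` makes `exp (l * ε) * δ = exp t`, leaving room `t` for the exponent.
  refine isDifferentiallyPrivate_gGaussMechanism hpe hp (l := 2 * t / ε) (by positivity) hσ0
    ?_ ?_ ?_
  · have h0 : 0 ≤ p * σ⁻¹ := by positivity
    have h1 : ε * Q / c ≤ 1 := by
      rw [div_le_one (by linarith)]
      nlinarith [mul_le_mul_of_nonneg_right hεC hQ.le]
    nlinarith
  · calc 20 * (2 * t / ε * p * σ⁻¹) = 40 / ε * (t * (p * σ⁻¹)) := by ring
      _ ≤ 40 / ε * (ε * Q / c) := by gcongr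
      _ = 40 * Q / c := by field_simp
      _ ≤ 1 := by rw [div_le_one (by linarith)]; linarith
  · rw [← htδ, ← Real.exp_add]
    refine Real.exp_le_exp.2 ?_
    calc _ ≤ 228 * (2 * t / ε + (2 * t / ε) ^ 2) * (ε ^ 2 / (c * t)) := by gcongr
      _ = 456 * (ε + 2 * t) / c := by field_simp; ring
      _ ≤ 456 * ((C₁ + 2) * t) / c := by gcongr; nlinarith
      _ = 456 * (C₁ + 2) / c * t := by ring
      _ ≤ 1 * t := by gcongr; rw [div_le_one (by linarith)]; linarith
      _ = _ := by field_simp; ring
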